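/- Let $S$ be a nonempty measurable space (for instance a topological space with its Borel $\sigma$-algebra) and let $P$ be the one-step transition kernel of a homogeneous Markov chain on $S$, $\mathbb P_x(1,\cdot)=P(x,\cdot)$, with $n$-step kernels $\mathbb P_x(n,\cdot)=P^n(x,\cdot)$. For $x^1,x^2\in S$ put $$\kappa(x^1,x^2)=\int\Big(\frac{\mathbb P_{x^2}(1,dy)}{\mathbb P_{x^1}(1,dy)}\wedge 1\Big)\,\mathbb P_{x^1}(1,dy),\qquad \kappa=\inf_{x^1,x^2\in S}\kappa(x^1,x^2),$$ where the ratio is the density of the absolutely continuous component. Let $p_1,p_2$ be the densities of $\mathbb P_{x^1}(1,\cdot),\mathbb P_{x^2}(1,\cdot)$ with respect to $\Lambda=\frac12(\mathbb P_{x^1}(1,\cdot)+\mathbb P_{x^2}(1,\cdot))$. Started from $(x^1,x^2)$, the pair $(\eta^1_1,\eta^2_1)$ has independent components with densities $\frac{p_1-p_1\wedge p_2}{1-\kappa(x^1,x^2)}$ and $\frac{p_2-p_1\wedge p_2}{1-\kappa(x^1,x^2)}$ with respect to $\Lambda$ if $\kappa(x^1,x^2)<1$, and independent components both with law $\mathbb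 P_{x^1}(1,\cdot)$ if $\kappa(x^1,x^2)=1$. For bounded measurable functions $h$ on $S\times S$ let $$Vh(x^1,x^2)=(1-\kappa(x^1,x^2))\,\mathbb E_{x^1,x^2}h(\eta^1_1,\eta^2_1).$$ Assume that $Vh$ is measurable for every bounded measurable $h$ (automatic if the $\sigma$-algebra of $S$ is countably generated), so that $V$ is a bounded operator on the Banach space of bounded measurable (complex-valued) functions on $S\times S$ with the sup-norm, and let $r(V)$ be its spectral radius. Let $\|\cdot\|_{TV}$ be the total variation norm of signed measures (so $\|\nu-\nu'\|_{TV}=2\sup_A|\nu(A)-\nu'(A)|$ for probability measures). If $r(V)<1$, then the chain has a unique invariant probability measure $\mu$, and the distribution of the chain converges to $\mu$ exponentially fast in total variation: 1. for every initial distribution $\mu_0$ and every $\rho>r(V)$ there is a constant $C$ such that the distribution $\mu_n=\mu_0P^n$ satisfies $\|\mu_n-\mu\|_{TV}\le C\rho^n$ for all $n\ge 0$; 2. for every $x\in S$ and every $\varepsilon>0$ there is $N$ such that $\|\mathbb P_x(n,\cdot)-\mu\|_{TV}\le (r(V)+\varepsilon)^n$ for all $n\ge N$; 3. if $r(V)<1-\kappa$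 and $0<\varepsilon<1-\kappa-r(V)$, then for every $x\in S$ there is $N$ such that $\|\mathbb P_x(n,\cdot)-\mu\|_{TV}\le (r(V)+\varepsilon)^n<(1-\kappa)^n$ for all $n\ge N$, i.e. the bound is strictly better than the Markov–Dobrushin bound $(1-\kappa)^n$. -/

import Mathlib

open MeasureTheory ProbabilityTheory
open scoped ENNReal

noncomputable section

namespace MarkovCoupling

/-! ### Overlap of two laws and the laws of the uncoupled components -/

section Overlap

variable {S : Type*} [MeasurableSpace S]

/-- The coefficient `∫ (dν/dμ ∧ 1) dμ`, where `dν/dμ` is the density of the absolutely continuous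
component of `ν` with respect to `μ`. -/
def overlap (μ ν : Measure S) : ℝ :=
  (∫⁻ y, min (ν.rnDeriv μ y) 1 ∂μ).toReal

/-- The reference measure `Λ = (μ + ν) / 2`. -/
def refMeasure (μ ν : Measure S) : Measure S := (2 : ℝ≥0∞)⁻¹ • (μ + ν)

/-- With `p`, `q` the densities of `μ`, `ν` with respect to `Λ = (μ + ν) / 2` and `κ` the overlap of
`μ` and `ν`, the probability law with density `(p - p ∧ q) / (1 - κ)` with respect to `Λ`. In the
degenerate case `κ = 1` (which means `μ = ν`) it is `μ`. -/
def residualLaw (μ ν : Measure S) : Measure S :=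
  open Classical in
  if overlap μ ν = 1 then μ else
    (refMeasure μ ν).withDensity fun y =>
      (μ.rnDeriv (refMeasure μ ν) y -
        min (μ.rnDeriv (refMeasure μ ν) y) (ν.rnDeriv (refMeasure μ ν) y)) /
        ENNReal.ofReal (1 - overlap μ ν)

/-- The total variation norm `‖μ - ν‖_TV`, i.e. the total mass of the variation of the signed
measure `μ - ν`. -/
def tvDist (μ ν : Measure S) [IsFiniteMeasure μ] [IsFiniteMeasure ν] : ℝ :=
  (μ.toSignedMeasure - ν.toSignedMeasure).totalVariation.real Set.univ

instance (μ ν : Measure S) [IsFiniteMeasure μ] [IsFiniteMeasure ν] :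
    IsFiniteMeasure (refMeasure μ ν) := by
  unfold refMeasure
  exact Measure.smul_finite _ (by simp)

theorem ac_refMeasure_left (μ ν : Measure S) : μ ≪ refMeasure μ ν := by
  have h : μ ≪ μ + ν := (Measure.AbsolutelyContinuous.refl μ).add_right ν
  exact h.trans (Measure.absolutelyContinuous_smul (by simp))

theorem ac_refMeasure_right (μ ν : Measure S) : ν ≪ refMeasure μ ν := by
  have h : ν ≪ μ + ν := by
    rw [add_comm]
    exact (Measure.AbsolutelyContinuous.refl ν).add_right μ
  exact h.trans (Measure.absolutelyContinuous_smul (by simp))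

theorem lintegral_min_le_one (μ ν : Measure S) [IsProbabilityMeasure μ] :
    ∫⁻ y, min (ν.rnDeriv μ y) 1 ∂μ ≤ 1 := by
  calc ∫⁻ y, min (ν.rnDeriv μ y) 1 ∂μ ≤ ∫⁻ _, 1 ∂μ := lintegral_mono fun y => min_le_right _ _
    _ = 1 := by simp

theorem overlap_nonneg (μ ν : Measure S) : 0 ≤ overlap μ ν := ENNReal.toReal_nonneg

theorem overlap_le_one (μ ν : Measure S) [IsProbabilityMeasure μ] : overlap μ ν ≤ 1 :=
  ENNReal.toReal_le_of_le_ofReal zero_le_one (by simpa using lintegral_min_le_one μ ν)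

/-- The overlap is the `Λ`-integral of the minimum of the two densities. -/
theorem lintegral_min_rnDeriv_refMeasure (μ ν : Measure S) [IsProbabilityMeasure μ]
    [IsProbabilityMeasure ν] :
    ∫⁻ y, min (μ.rnDeriv (refMeasure μ ν) y) (ν.rnDeriv (refMeasure μ ν) y) ∂(refMeasure μ ν) =
      ENNReal.ofReal (overlap μ ν) := by
  set L := refMeasure μ ν with hL
  have hμ : μ ≪ L := ac_refMeasure_left μ ν
  have hν : ν ≪ L := ac_refMeasure_right μ ν
  have h1 : ENNReal.ofReal (overlap μ ν) = ∫⁻ y, min (ν.rnDeriv μ y) 1 ∂μ :=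
    ENNReal.ofReal_toReal ((lintegral_min_le_one μ ν).trans_lt ENNReal.one_lt_top).ne
  have h2 : ∫⁻ y, min (ν.rnDeriv μ y) 1 ∂μ =
      ∫⁻ y, min (ν.rnDeriv L y / μ.rnDeriv L y) 1 ∂μ := by
    apply lintegral_congr_ae
    filter_upwards [Measure.rnDeriv_eq_div hν hμ] with y hy
    rw [hy]
  have h3 : ∫⁻ y, min (ν.rnDeriv L y / μ.rnDeriv L y) 1 ∂μ =
      ∫⁻ y, μ.rnDeriv L y * min (ν.rnDeriv L y / μ.rnDeriv L y) 1 ∂L :=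
    (lintegral_rnDeriv_mul hμ (by fun_prop)).symm
  rw [h1, h2, h3]
  apply lintegral_congr_ae
  filter_upwards [μ.rnDeriv_lt_top L] with y hy
  rcases eq_or_ne (μ.rnDeriv L y) 0 with h0 | h0
  · simp [h0]
  · rw [mul_min, ENNReal.mul_div_cancel h0 hy.ne, mul_one, min_comm]

instance (μ ν : Measure S) [IsProbabilityMeasure μ] [IsProbabilityMeasure ν] :
    IsProbabilityMeasure (residualLaw μ ν) := by
  unfold residualLaw
  split_ifs with h
  · infer_instance
  constructor
  have hlt : 0 < 1 - overlap μ ν := sub_pos.2 (lt_of_le_of_ne (overlap_le_one μ ν) h)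
  have hm : Measurable fun y => min (μ.rnDeriv (refMeasure μ ν) y)
      (ν.rnDeriv (refMeasure μ ν) y) := by fun_prop
  rw [withDensity_apply _ MeasurableSet.univ, Measure.restrict_univ]
  simp_rw [div_eq_mul_inv]
  rw [lintegral_mul_const _ (by fun_prop), lintegral_sub hm, lintegral_min_rnDeriv_refMeasure,
    Measure.lintegral_rnDeriv (ac_refMeasure_left μ ν), measure_univ, ← ENNReal.ofReal_one,
    ← ENNReal.ofReal_sub _ (overlap_nonneg μ ν), ENNReal.ofReal_one]
  · exact ENNReal.mul_inv_cancel (ENNReal.ofReal_pos.2 hlt).ne' ENNReal.ofReal_ne_top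
  · rw [lintegral_min_rnDeriv_refMeasure]
    exact ENNReal.ofReal_ne_top
  · exact Filter.Eventually.of_forall fun y => min_le_left _ _

end Overlap

/-! ### The Banach space of bounded measurable functions -/

/-- The subspace of the measurable functions in the space `ℓ^∞(X)` of bounded functions. -/
def bddMeasSubmodule (X : Type*) [MeasurableSpace X] : Submodule ℂ (lp (fun _ : X => ℂ) ∞) where
  carrier := {f | Measurable (f : X → ℂ)}
  add_mem' {f g} hf hg := by
    change Measurable (⇑(f + g))
    rw [lp.coeFn_add]
    exact Measurable.add hf hg
  zero_mem' := by
    change Measurable (⇑(0 : lp (fun _ : X => ℂ) ∞))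
    rw [lp.coeFn_zero]
    exact measurable_const
  smul_mem' c f hf := by
    change Measurable (⇑(c • f))
    rw [lp.coeFn_smul]
    exact Measurable.const_smul hf c

/-- The space of bounded measurable complex-valued functions on `X`, with the sup-norm. -/
def BddMeas (X : Type*) [MeasurableSpace X] : Type _ := ↥(bddMeasSubmodule X)

instance (X : Type*) [MeasurableSpace X] : NormedAddCommGroup (BddMeas X) :=
  inferInstanceAs (NormedAddCommGroup ↥(bddMeasSubmodule X))

instance (X : Type*) [MeasurableSpace X] : NormedSpace ℂ (BddMeas X) :=
  inferInstanceAs (NormedSpace ℂ ↥(bddMeasSubmodule X))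

instance (X : Type*) [MeasurableSpace X] : CompleteSpace (BddMeas X) := by
  have h : IsClosed (bddMeasSubmodule X : Set (lp (fun _ : X => ℂ) ∞)) := by
    apply isSeqClosed_iff_isClosed.1
    intro f g hf hg
    refine measurable_of_tendsto_metrizable (f := fun n x => f n x) (fun n => hf n) ?_
    rw [tendsto_pi_nhds]
    intro x
    exact ((lp.lipschitzWith_one_eval ∞ x).continuous.tendsto g).comp hg
  exact h.completeSpace_coe

theorem measurable_coe {X : Type*} [MeasurableSpace X] (h : BddMeas X) :
    Measurable fun x => h.1 x := h.2

theorem norm_coe_le {X : Type*} [MeasurableSpace X] (h : BddMeas X) (x : X) :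
    ‖h.1 x‖ ≤ ‖h‖ := lp.norm_apply_le_norm (by simp) h.1 x

theorem integrable_coe {X : Type*} [MeasurableSpace X] (h : BddMeas X) (μ : Measure X)
    [IsFiniteMeasure μ] : Integrable (fun x => h.1 x) μ :=
  Integrable.of_bound (measurable_coe h).aestronglyMeasurable ‖h‖
    (Filter.Eventually.of_forall (norm_coe_le h))

/-! ### The coupled chain and the operator `V` -/

section Operator

variable {S : Type*} [MeasurableSpace S]

instance (P : Kernel S S) [IsMarkovKernel P] (n : ℕ) : IsMarkovKernel (P ^ n) := by
  induction n with
  | zero => exact inferInstanceAs (IsMarkovKernel (Kernel.id : Kernel S S))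
  | succ n ih =>
    rw [pow_succ]
    exact inferInstanceAs (IsMarkovKernel ((P ^ n) ∘ₖ P))

/-- `κ(x, x')`: the overlap of the one-step transition laws from `x` and from `x'`. -/
def kappa (P : Kernel S S) (x x' : S) : ℝ := overlap (P x) (P x')

/-- The Markov–Dobrushin coefficient `κ = inf_{x, x'} κ(x, x')`. -/
def kappaInf (P : Kernel S S) : ℝ := ⨅ x : S × S, kappa P x.1 x.2

/-- One-step transition law of the pair `(η¹, η²)`, i.e. of the coupled pair given that coupling
does not take place at that step: from `(x¹, x²)` the two components move independently, with
densities `(p(x¹, ·) - p(x¹, ·) ∧ p(x², ·)) / (1 - κ(x¹, x²))` and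
`(p(x², ·) - p(x¹, ·) ∧ p(x², ·)) / (1 - κ(x¹, x²))`. -/
def pairStep (P : Kernel S S) (x : S × S) : Measure (S × S) :=
  (residualLaw (P x.1) (P x.2)).prod (residualLaw (P x.2) (P x.1))

instance (P : Kernel S S) [IsMarkovKernel P] (x : S × S) :
    IsProbabilityMeasure (pairStep P x) := by
  unfold pairStep
  infer_instance

/-- `V h (x) = (1 - κ(x¹, x²)) E_x h(η¹₁, η²₁)`. -/
def vFun (P : Kernel S S) (h : S × S → ℂ) (x : S × S) : ℂ :=
  ((1 - kappa P x.1 x.2 : ℝ) : ℂ) * ∫ y, h y ∂(pairStep P x)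

/-- `V` maps bounded measurable functions to measurable functions. -/
def PreservesMeasurable (P : Kernel S S) : Prop :=
  ∀ h : S × S → ℂ, Measurable h → (∃ C : ℝ, ∀ x, ‖h x‖ ≤ C) → Measurable (vFun P h)

theorem norm_vFun_le (P : Kernel S S) [IsMarkovKernel P] (h : BddMeas (S × S)) (x : S × S) :
    ‖vFun P (fun y => h.1 y) x‖ ≤ ‖h‖ := by
  have h0 : 0 ≤ kappa P x.1 x.2 := overlap_nonneg _ _
  have h1 : kappa P x.1 x.2 ≤ 1 := overlap_le_one _ _
  have h2 : ‖∫ y, h.1 y ∂(pairStep P x)‖ ≤ ‖h‖ := by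
    simpa using norm_integral_le_of_norm_le_const (μ := pairStep P x)
      (Filter.Eventually.of_forall (norm_coe_le h))
  rw [vFun, norm_mul, Complex.norm_real, Real.norm_of_nonneg (by linarith)]
  calc (1 - kappa P x.1 x.2) * ‖∫ y, h.1 y ∂(pairStep P x)‖ ≤ 1 * ‖h‖ :=
        mul_le_mul (by linarith) h2 (norm_nonneg _) zero_le_one
    _ = ‖h‖ := one_mul _

theorem measurable_overlap_residual [MeasurableSpace.CountablyGenerated S] (P : Kernel S S)
    [IsMarkovKernel P] : (Measurable fun x : S × S => overlap (P x.1) (P x.2)) ∧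
      Measurable fun x : S × S => residualLaw (P x.1) (P x.2) := by
  let K₁ : Kernel (S × S) S := P.comap Prod.fst measurable_fst
  let K₂ : Kernel (S × S) S := P.comap Prod.snd measurable_snd
  let L : Kernel (S × S) S :=
    ⟨fun x => refMeasure (P x.1) (P x.2), Measure.measurable_of_measurable_coe _ fun A hA => by
      simp only [refMeasure, Measure.smul_apply, Measure.add_apply, smul_eq_mul]
      exact ((K₁.measurable_coe hA).add (K₂.measurable_coe hA)).const_mul _⟩
  have hLx : ∀ x, L x = refMeasure (P x.1) (P x.2) := fun _ => rfl
  have : IsMarkovKernel L := ⟨fun x => ⟨by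
    rw [hLx, refMeasure, Measure.smul_apply, Measure.add_apply, measure_univ, measure_univ,
      one_add_one_eq_two, smul_eq_mul, ENNReal.inv_mul_cancel (by simp) (by simp)]⟩⟩
  have h₁ : ∀ x, Kernel.rnDeriv K₁ L x =ᵐ[L x] (P x.1).rnDeriv (L x) := fun x =>
    Kernel.rnDeriv_eq_rnDeriv_measure
  have h₂ : ∀ x, Kernel.rnDeriv K₂ L x =ᵐ[L x] (P x.2).rnDeriv (L x) := fun x =>
    Kernel.rnDeriv_eq_rnDeriv_measure
  have m₁ : Measurable fun q : (S × S) × S => Kernel.rnDeriv K₁ L q.1 q.2 :=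
    Kernel.measurable_rnDeriv K₁ L
  have m₂ : Measurable fun q : (S × S) × S => Kernel.rnDeriv K₂ L q.1 q.2 :=
    Kernel.measurable_rnDeriv K₂ L
  have hκ : Measurable fun x : S × S => overlap (P x.1) (P x.2) := by
    have h : (fun x : S × S => overlap (P x.1) (P x.2)) = fun x =>
        (∫⁻ y, min (Kernel.rnDeriv K₁ L x y) (Kernel.rnDeriv K₂ L x y) ∂(L x)).toReal := by
      ext x
      rw [← ENNReal.toReal_ofReal (overlap_nonneg (P x.1) (P x.2)),
        ← lintegral_min_rnDeriv_refMeasure]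
      congr 1
      apply lintegral_congr_ae
      filter_upwards [h₁ x, h₂ x] with y e₁ e₂
      rw [e₁, e₂, hLx]
    rw [h]
    exact (Measurable.lintegral_kernel_prod_right (m₁.min m₂)).ennreal_toReal
  refine ⟨hκ, Measure.measurable_of_measurable_coe _ fun A hA => ?_⟩
  have h : (fun x : S × S => residualLaw (P x.1) (P x.2) A) = fun x =>
      open Classical in
      if overlap (P x.1) (P x.2) = 1 then K₁ x A else
        ∫⁻ y in A, (Kernel.rnDeriv K₁ L x y -
          min (Kernel.rnDeriv K₁ L x y) (Kernel.rnDeriv K₂ L x y)) /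
          ENNReal.ofReal (1 - overlap (P x.1) (P x.2)) ∂(L x) := by
    ext x
    unfold residualLaw
    split_ifs with hx
    · rfl
    · rw [withDensity_apply _ hA, ← hLx]
      apply lintegral_congr_ae
      filter_upwards [ae_restrict_of_ae (h₁ x), ae_restrict_of_ae (h₂ x)] with y e₁ e₂
      rw [e₁, e₂]
  rw [h]
  classical
  refine Measurable.ite (hκ (measurableSet_singleton 1)) (K₁.measurable_coe hA) ?_
  refine Measurable.setLIntegral_kernel_prod_right ?_ hA
  exact (m₁.sub (m₁.min m₂)).div
    ((measurable_const.sub (hκ.comp measurable_fst)).ennreal_ofReal)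

/-- If the σ-algebra of `S` is countably generated, then `V` always maps bounded measurable
functions to measurable functions. -/
theorem preservesMeasurable_of_countablyGenerated [MeasurableSpace.CountablyGenerated S]
    (P : Kernel S S) [IsMarkovKernel P] : PreservesMeasurable P := by
  obtain ⟨hκ, hres⟩ := measurable_overlap_residual P
  intro h hm _
  let R₁ : Kernel (S × S) S := ⟨fun x => residualLaw (P x.1) (P x.2), hres⟩
  let R₂ : Kernel (S × S) S := ⟨fun x => residualLaw (P x.2) (P x.1), hres.comp measurable_swap⟩
  have : IsMarkovKernel R₁ :=
    ⟨fun x => inferInstanceAs (IsProbabilityMeasure (residualLaw (P x.1) (P x.2)))⟩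
  have : IsMarkovKernel R₂ :=
    ⟨fun x => inferInstanceAs (IsProbabilityMeasure (residualLaw (P x.2) (P x.1)))⟩
  have hint : Measurable fun x : S × S => ∫ y, h y ∂(pairStep P x) := by
    have e : ∀ x, pairStep P x = (R₁ ×ₖ R₂) x := fun x => by
      rw [Kernel.prod_apply]
      rfl
    simp_rw [e]
    exact hm.stronglyMeasurable.integral_kernel.measurable
  exact (Complex.measurable_ofReal.comp (measurable_const.sub hκ)).mul hint

/-- The operator `V` on the Banach space of bounded measurable functions on `S × S`. -/
def V (P : Kernel S S) [IsMarkovKernel P] (hP : PreservesMeasurable P) :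
    BddMeas (S × S) →L[ℂ] BddMeas (S × S) :=
  LinearMap.mkContinuous
    { toFun := fun h =>
        ⟨⟨vFun P fun y => h.1 y, memℓp_infty ⟨‖h‖, by
            rintro _ ⟨x, rfl⟩
            exact norm_vFun_le P h x⟩⟩,
          hP _ (measurable_coe h) ⟨‖h‖, (norm_coe_le h)⟩⟩
      map_add' := fun g h => by
        refine Subtype.ext (lp.ext (funext fun x => ?_))
        change vFun P (fun y => g.1 y + h.1 y) x =
          vFun P (fun y => g.1 y) x + vFun P (fun y => h.1 y) x
        simp only [vFun]
        rw [integral_add (integrable_coe g _) (integrable_coe h _), mul_add]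
      map_smul' := fun c h => by
        refine Subtype.ext (lp.ext (funext fun x => ?_))
        change vFun P (fun y => c * h.1 y) x = c * vFun P (fun y => h.1 y) x
        simp only [vFun]
        rw [integral_const_mul]
        ring }
    1 fun h => by
      rw [one_mul]
      exact lp.norm_le_of_forall_le (norm_nonneg _) fun x => norm_vFun_le P h x

/-- The spectral radius `r(V)`. -/
def rV (P : Kernel S S) [IsMarkovKernel P] (hP : PreservesMeasurable P) : ℝ :=
  (spectralRadius ℂ (V P hP)).toReal

end Operator

end MarkovCoupling

end

open MarkovCoupling

/-! The coupling enters only through an algebraic identity. The laws `P(x¹, ·)` and `P(x², ·)` share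
the common part with density `p₁ ∧ p₂`, and what remains of each of them is `1 - κ(x¹, x²)` times
its residual law (`commonPart_add_residualLaw`). Hence, for `D f (x¹, x²) = f (x¹) - f (x²)`, the
common parts cancel and `D (P f) = V (D f)` (`V_pairDiff`). This uses only the marginals of the
pair `(η¹, η²)`, and no coupled process has to be constructed. By iteration
`D (Pⁿ f) = Vⁿ (D f)`, and for the indicator `f` of a set `‖D f‖ ≤ 1`; integrating over the initial
distributions, any two of them lead to laws at time `n` that differ by at most `‖Vⁿ‖` on every set
(`abs_bind_pow_real_sub_le`), and so by at most `2 ‖Vⁿ‖` in total variation.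

By Gelfand's formula `c ‖Vⁿ‖ ≤ ρⁿ` for large `n`, whenever `ρ > r(V)` and `c` is a constant
(`eventually_mul_norm_pow_le`). If `r(V) < 1`, this gives uniqueness of the invariant law and all
the rates. It also makes the laws `Pⁿ(x, ·)` a Cauchy sequence uniformly on sets; their limit is a
probability measure (`exists_isProbabilityMeasure_of_uniform_cauchy`), and it is invariant because a
Markov kernel is a contraction for uniform closeness on sets (`bind_apply_le_add`). -/

open Filter Topology

namespace MarkovCoupling

/-! ### The decomposition of a law into a common part and a residual part -/

section Decomposition

variable {S : Type*} [MeasurableSpace S]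

theorem refMeasure_comm (μ ν : Measure S) : refMeasure μ ν = refMeasure ν μ := by
  rw [refMeasure, refMeasure, add_comm]

/-- The common part `p ∧ q` of two laws, where `p` and `q` are their densities with respect to
`Λ = (μ + ν) / 2`. -/
noncomputable def commonPart (μ ν : Measure S) : Measure S :=
  (refMeasure μ ν).withDensity fun y =>
    min (μ.rnDeriv (refMeasure μ ν) y) (ν.rnDeriv (refMeasure μ ν) y)

theorem commonPart_comm (μ ν : Measure S) : commonPart μ ν = commonPart ν μ := by
  simp only [commonPart, refMeasure_comm ν μ]
  simp only [min_comm]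

theorem commonPart_univ (μ ν : Measure S) [IsProbabilityMeasure μ] [IsProbabilityMeasure ν] :
    commonPart μ ν Set.univ = ENNReal.ofReal (overlap μ ν) := by
  rw [commonPart, withDensity_apply _ MeasurableSet.univ, Measure.restrict_univ,
    lintegral_min_rnDeriv_refMeasure]

theorem overlap_comm (μ ν : Measure S) [IsProbabilityMeasure μ] [IsProbabilityMeasure ν] :
    overlap μ ν = overlap ν μ := by
  rw [← ENNReal.toReal_ofReal (overlap_nonneg μ ν), ← commonPart_univ, commonPart_comm,
    commonPart_univ, ENNReal.toReal_ofReal (overlap_nonneg ν μ)]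

theorem commonPart_le_left (μ ν : Measure S) [IsFiniteMeasure μ] [IsFiniteMeasure ν] :
    commonPart μ ν ≤ μ := by
  calc commonPart μ ν ≤ (refMeasure μ ν).withDensity (μ.rnDeriv (refMeasure μ ν)) :=
        withDensity_mono (Eventually.of_forall fun _ => min_le_left _ _)
    _ = μ := Measure.withDensity_rnDeriv_eq _ _ (ac_refMeasure_left μ ν)

/-- A law is the sum of its common part with another law and of a multiple of the residual law. In
the case `overlap μ ν = 1` the residual law has weight zero, and `μ` is its own common part. -/
theorem commonPart_add_residualLaw (μ ν : Measure S) [IsProbabilityMeasure μ]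
    [IsProbabilityMeasure ν] :
    commonPart μ ν + ENNReal.ofReal (1 - overlap μ ν) • residualLaw μ ν = μ := by
  by_cases h : overlap μ ν = 1
  · have : IsFiniteMeasure (commonPart μ ν) := isFiniteMeasure_of_le μ (commonPart_le_left μ ν)
    rw [h, sub_self, ENNReal.ofReal_zero, zero_smul, add_zero]
    refine Measure.eq_of_le_of_measure_univ_eq (commonPart_le_left μ ν) ?_
    rw [commonPart_univ, h, measure_univ, ENNReal.ofReal_one]
  · have hlt : 0 < 1 - overlap μ ν := sub_pos.2 (lt_of_le_of_ne (overlap_le_one μ ν) h)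
    rw [residualLaw, if_neg h, ← withDensity_smul _ (by fun_prop), commonPart,
      ← withDensity_add_left (by fun_prop)]
    conv_rhs => rw [← Measure.withDensity_rnDeriv_eq _ _ (ac_refMeasure_left μ ν)]
    congr 1
    ext y
    simp only [Pi.add_apply, Pi.smul_apply, smul_eq_mul]
    rw [ENNReal.mul_div_cancel (ENNReal.ofReal_pos.2 hlt).ne' ENNReal.ofReal_ne_top]
    exact add_tsub_cancel_of_le (min_le_left _ _)

theorem integral_eq_commonPart_add (μ ν : Measure S) [IsProbabilityMeasure μ]
    [IsProbabilityMeasure ν] (f : BddMeas S) :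
    ∫ y, f.1 y ∂μ = ∫ y, f.1 y ∂(commonPart μ ν) +
      ((1 - overlap μ ν : ℝ) : ℂ) * ∫ y, f.1 y ∂(residualLaw μ ν) := by
  have : IsFiniteMeasure (commonPart μ ν) :=
    isFiniteMeasure_of_le μ (commonPart_le_left μ ν)
  conv_lhs => rw [← commonPart_add_residualLaw μ ν]
  rw [integral_add_measure (integrable_coe f _)
    ((integrable_coe f _).smul_measure ENNReal.ofReal_ne_top), integral_smul_measure,
    ENNReal.toReal_ofReal (sub_nonneg.2 (overlap_le_one μ ν)), Complex.real_smul]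

end Decomposition

/-! ### The operator on differences `f (x¹) - f (x²)` -/

section Difference

variable {S : Type*} [MeasurableSpace S]

/-- A bounded measurable function as an element of `BddMeas`. -/
def BddMeas.of {X : Type*} [MeasurableSpace X] (f : X → ℂ) (hf : Measurable f) (C : ℝ)
    (hC : ∀ x, ‖f x‖ ≤ C) : BddMeas X :=
  ⟨⟨f, memℓp_infty ⟨C, by rintro _ ⟨x, rfl⟩; exact hC x⟩⟩, hf⟩

theorem BddMeas.ext {X : Type*} [MeasurableSpace X] {f g : BddMeas X} (h : ∀ x, f.1 x = g.1 x) :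
    f = g :=
  Subtype.ext (lp.ext (funext h))

/-- The indicator of a measurable set as a bounded measurable function. -/
noncomputable def BddMeas.indicator {A : Set S} (hA : MeasurableSet A) : BddMeas S :=
  BddMeas.of (A.indicator 1) (measurable_one.indicator hA) 1 fun x => by
    by_cases h : x ∈ A <;> simp [h]

/-- The function `(x¹, x²) ↦ f (x¹) - f (x²)`. -/
noncomputable def pairDiff (f : BddMeas S) : BddMeas (S × S) :=
  BddMeas.of (fun x => f.1 x.1 - f.1 x.2)
    (((measurable_coe f).comp measurable_fst).sub ((measurable_coe f).comp measurable_snd))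
    (‖f‖ + ‖f‖) fun _ => (norm_sub_le _ _).trans (add_le_add (norm_coe_le f _) (norm_coe_le f _))

/-- The transition operator `P f (x) = ∫ f dP(x, ·)`. -/
noncomputable def transition (P : Kernel S S) [IsMarkovKernel P] (f : BddMeas S) : BddMeas S :=
  BddMeas.of (fun x => ∫ y, f.1 y ∂(P x))
    (measurable_coe f).stronglyMeasurable.integral_kernel.measurable ‖f‖ fun x => by
      simpa using norm_integral_le_of_norm_le_const (μ := P x)
        (Eventually.of_forall (norm_coe_le f))

/-- The common parts of the laws `P(x¹, ·)` and `P(x², ·)` cancel in the difference, and `V` is what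
is left. -/
theorem V_pairDiff (P : Kernel S S) [IsMarkovKernel P] (hP : PreservesMeasurable P)
    (f : BddMeas S) : V P hP (pairDiff f) = pairDiff (transition P f) := by
  refine BddMeas.ext fun x => ?_
  change ((1 - overlap (P x.1) (P x.2) : ℝ) : ℂ) *
      ∫ y, (f.1 y.1 - f.1 y.2) ∂(residualLaw (P x.1) (P x.2)).prod (residualLaw (P x.2) (P x.1)) =
    (∫ y, f.1 y ∂(P x.1)) - ∫ y, f.1 y ∂(P x.2)
  have hfst : Integrable (fun y : S × S => f.1 y.1)
      ((residualLaw (P x.1) (P x.2)).prod (residualLaw (P x.2) (P x.1))) :=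
    (integrable_coe f _).comp_fst _
  have hsnd : Integrable (fun y : S × S => f.1 y.2)
      ((residualLaw (P x.1) (P x.2)).prod (residualLaw (P x.2) (P x.1))) :=
    (integrable_coe f _).comp_snd _
  rw [integral_sub hfst hsnd, integral_fun_fst (fun y => f.1 y), integral_fun_snd (fun y => f.1 y),
    integral_eq_commonPart_add (P x.1) (P x.2), integral_eq_commonPart_add (P x.2) (P x.1),
    commonPart_comm (P x.2), overlap_comm (P x.2)]
  simp only [probReal_univ, one_smul]
  ring

theorem transition_iterate_apply (P : Kernel S S) [IsMarkovKernel P] (n : ℕ) (f : BddMeas S)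
    (x : S) : ((transition P)^[n] f).1 x = ∫ y, f.1 y ∂((P ^ n) x) := by
  induction n generalizing f with
  | zero =>
    change f.1 x = ∫ y, f.1 y ∂(Kernel.id x)
    rw [Kernel.id_apply, integral_dirac' _ _ (measurable_coe f).stronglyMeasurable]
  | succ n ih =>
    rw [Function.iterate_succ_apply, ih, pow_succ']
    exact (Kernel.integral_comp (integrable_coe f ((P ∘ₖ (P ^ n)) x))).symm

theorem V_pow_pairDiff (P : Kernel S S) [IsMarkovKernel P] (hP : PreservesMeasurable P) (n : ℕ)
    (f : BddMeas S) : (V P hP ^ n) (pairDiff f) = pairDiff ((transition P)^[n] f) := by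
  induction n generalizing f with
  | zero => rfl
  | succ n ih =>
    rw [pow_succ, mul_apply_eq_comp, V_pairDiff, ih, Function.iterate_succ_apply]

theorem norm_pairDiff_indicator_le {A : Set S} (hA : MeasurableSet A) :
    ‖pairDiff (BddMeas.indicator hA)‖ ≤ 1 := by
  refine lp.norm_le_of_forall_le zero_le_one fun x => ?_
  change ‖A.indicator (1 : S → ℂ) x.1 - A.indicator (1 : S → ℂ) x.2‖ ≤ 1
  by_cases h1 : x.1 ∈ A <;> by_cases h2 : x.2 ∈ A <;> simp [h1, h2]

/-- The laws at time `n` from two starting points differ by at most `‖V ^ n‖` on every set: the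
indicator of a set takes values in `[0, 1]`, so its differences have norm at most one. -/
theorem abs_pow_real_sub_le (P : Kernel S S) [IsMarkovKernel P] (hP : PreservesMeasurable P)
    (n : ℕ) (x y : S) {A : Set S} (hA : MeasurableSet A) :
    |((P ^ n) x).real A - ((P ^ n) y).real A| ≤ ‖V P hP ^ n‖ := by
  have key : ((V P hP ^ n) (pairDiff (BddMeas.indicator hA))).1 (x, y) =
      ((((P ^ n) x).real A - ((P ^ n) y).real A : ℝ) : ℂ) := by
    rw [V_pow_pairDiff]
    change ((transition P)^[n] (BddMeas.indicator hA)).1 x -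
      ((transition P)^[n] (BddMeas.indicator hA)).1 y = _
    have hint : ∀ z, ∫ w, (BddMeas.indicator hA).1 w ∂((P ^ n) z) = (((P ^ n) z).real A : ℂ) := by
      intro z
      change ∫ w, A.indicator (1 : S → ℂ) w ∂((P ^ n) z) = _
      exact (integral_indicator_const (1 : ℂ) hA).trans (by rw [Complex.real_smul, mul_one])
    rw [transition_iterate_apply, transition_iterate_apply, hint, hint, Complex.ofReal_sub]
  calc |((P ^ n) x).real A - ((P ^ n) y).real A|
      = ‖((V P hP ^ n) (pairDiff (BddMeas.indicator hA))).1 (x, y)‖ := by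
        rw [key, Complex.norm_real, Real.norm_eq_abs]
    _ ≤ ‖(V P hP ^ n) (pairDiff (BddMeas.indicator hA))‖ := norm_coe_le _ _
    _ ≤ ‖V P hP ^ n‖ * ‖pairDiff (BddMeas.indicator hA)‖ := ContinuousLinearMap.le_opNorm _ _
    _ ≤ ‖V P hP ^ n‖ * 1 := by gcongr; exact norm_pairDiff_indicator_le hA
    _ = ‖V P hP ^ n‖ := mul_one _

theorem bind_pow_le_add (P : Kernel S S) [IsMarkovKernel P] (hP : PreservesMeasurable P)
    (n : ℕ) (α β : Measure S) [IsProbabilityMeasure α] [IsProbabilityMeasure β]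
    {A : Set S} (hA : MeasurableSet A) :
    ((P ^ n) ∘ₘ α) A ≤ ((P ^ n) ∘ₘ β) A + ENNReal.ofReal ‖V P hP ^ n‖ := by
  have hpt : ∀ x y, (P ^ n) x A ≤ (P ^ n) y A + ENNReal.ofReal ‖V P hP ^ n‖ := by
    intro x y
    rw [← ofReal_measureReal (μ := (P ^ n) x), ← ofReal_measureReal (μ := (P ^ n) y),
      ← ENNReal.ofReal_add measureReal_nonneg (norm_nonneg _)]
    refine ENNReal.ofReal_le_ofReal ?_
    linarith [(abs_le.1 (abs_pow_real_sub_le P hP n x y hA)).2]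
  rw [Measure.bind_apply hA (Kernel.aemeasurable _), Measure.bind_apply hA (Kernel.aemeasurable _)]
  have hx : ∀ x, (P ^ n) x A ≤ ∫⁻ y, (P ^ n) y A ∂β + ENNReal.ofReal ‖V P hP ^ n‖ := by
    intro x
    calc (P ^ n) x A = ∫⁻ _, (P ^ n) x A ∂β := by simp
      _ ≤ ∫⁻ y, ((P ^ n) y A + ENNReal.ofReal ‖V P hP ^ n‖) ∂β := lintegral_mono (hpt x)
      _ = _ := by rw [lintegral_add_right _ measurable_const]; simp
  calc ∫⁻ x, (P ^ n) x A ∂α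
      ≤ ∫⁻ _, (∫⁻ y, (P ^ n) y A ∂β + ENNReal.ofReal ‖V P hP ^ n‖) ∂α := lintegral_mono hx
    _ = _ := by simp

theorem abs_bind_pow_real_sub_le (P : Kernel S S) [IsMarkovKernel P] (hP : PreservesMeasurable P)
    (n : ℕ) (α β : Measure S) [IsProbabilityMeasure α] [IsProbabilityMeasure β]
    {A : Set S} (hA : MeasurableSet A) :
    |((P ^ n) ∘ₘ α).real A - ((P ^ n) ∘ₘ β).real A| ≤ ‖V P hP ^ n‖ := by
  have h : ∀ (α β : Measure S) [IsProbabilityMeasure α] [IsProbabilityMeasure β],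
      ((P ^ n) ∘ₘ α).real A ≤ ((P ^ n) ∘ₘ β).real A + ‖V P hP ^ n‖ := by
    intro α β _ _
    have := ENNReal.toReal_mono (by finiteness) (bind_pow_le_add P hP n α β hA)
    rwa [ENNReal.toReal_add (by finiteness) (by finiteness),
      ENNReal.toReal_ofReal (norm_nonneg _)] at this
  exact abs_sub_le_iff.2 ⟨by linarith [h α β], by linarith [h β α]⟩

end Difference

/-! ### Decay of the powers of `V` -/

section Gelfand

variable {A : Type*} [NormedRing A] [NormedAlgebra ℂ A] [CompleteSpace A]

theorem spectralRadius_ne_top (a : A) : spectralRadius ℂ a ≠ ∞ := by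
  have h := spectrum.spectralRadius_le_pow_nnnorm_pow_one_div ℂ a 0
  refine (h.trans_lt ?_).ne
  finiteness

/-- Gelfand's formula, as a bound on the powers; a constant factor is absorbed by passing to a
smaller rate. -/
theorem eventually_mul_norm_pow_le (a : A) {ρ : ℝ} (hρ : (spectralRadius ℂ a).toReal < ρ)
    (c : ℝ) : ∀ᶠ n : ℕ in atTop, c * ‖a ^ n‖ ≤ ρ ^ n := by
  obtain ⟨σ, hσ, hσρ⟩ := exists_between hρ
  have hσ0 : 0 < σ := ENNReal.toReal_nonneg.trans_lt hσ
  have hρ0 : 0 < ρ := hσ0.trans hσρ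
  have hlim := spectrum.pow_norm_pow_one_div_tendsto_nhds_spectralRadius a
  have hlt : spectralRadius ℂ a < ENNReal.ofReal σ :=
    (ENNReal.lt_ofReal_iff_toReal_lt (spectralRadius_ne_top a)).2 hσ
  have hsmall : Tendsto (fun n : ℕ => |c| * (σ / ρ) ^ n) atTop (𝓝 0) := by
    simpa using (tendsto_pow_atTop_nhds_zero_of_lt_one (by positivity)
      ((div_lt_one hρ0).2 hσρ)).const_mul |c|
  filter_upwards [hlim.eventually_lt_const hlt, hsmall.eventually_le_const one_pos,
    eventually_ge_atTop 1] with n hn hc h1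
  have hnorm : ‖a ^ n‖ ≤ σ ^ n := by
    have h2 : ‖a ^ n‖ ^ (1 / n : ℝ) ≤ σ := ((ENNReal.ofReal_lt_ofReal_iff hσ0).1 hn).le
    rw [one_div] at h2
    calc ‖a ^ n‖ = (‖a ^ n‖ ^ ((n : ℝ)⁻¹)) ^ n :=
          (Real.rpow_inv_natCast_pow (norm_nonneg _) (by omega)).symm
      _ ≤ σ ^ n := pow_le_pow_left₀ (by positivity) h2 n
  calc c * ‖a ^ n‖ ≤ |c| * σ ^ n := by gcongr; exact le_abs_self c
    _ = |c| * (σ / ρ) ^ n * ρ ^ n := by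
      rw [div_pow, mul_assoc, div_mul_cancel₀ _ (pow_pos hρ0 n).ne']
    _ ≤ 1 * ρ ^ n := by gcongr
    _ = ρ ^ n := one_mul _

theorem exists_norm_pow_le (a : A) {ρ : ℝ} (hρ : (spectralRadius ℂ a).toReal < ρ) :
    ∃ C : ℝ, ∀ n : ℕ, ‖a ^ n‖ ≤ C * ρ ^ n := by
  have hρ0 : 0 < ρ := ENNReal.toReal_nonneg.trans_lt hρ
  obtain ⟨N, hN⟩ := eventually_atTop.1 (eventually_mul_norm_pow_le a hρ 1)
  have hterm : ∀ k, 0 ≤ ‖a ^ k‖ / ρ ^ k := fun k => by positivity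
  refine ⟨1 + ∑ k ∈ Finset.range N, ‖a ^ k‖ / ρ ^ k, fun n => ?_⟩
  rw [← div_le_iff₀ (pow_pos hρ0 n)]
  by_cases hn : N ≤ n
  · have h := hN n hn
    rw [one_mul] at h
    have h1 : ‖a ^ n‖ / ρ ^ n ≤ 1 := (div_le_one (pow_pos hρ0 n)).2 h
    linarith [Finset.sum_nonneg fun k (_ : k ∈ Finset.range N) => hterm k]
  · have h := Finset.single_le_sum (fun k _ => hterm k) (Finset.mem_range.2 (not_le.1 hn))
    linarith

end Gelfand

/-! ### Limits of measures that converge uniformly on sets -/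

section Limit

variable {S : Type*} [MeasurableSpace S]

theorem tvDist_le_of_forall_abs_sub_le (μ ν : Measure S) [IsFiniteMeasure μ] [IsFiniteMeasure ν]
    {c : ℝ} (h : ∀ A, MeasurableSet A → |μ.real A - ν.real A| ≤ c) : tvDist μ ν ≤ 2 * c := by
  obtain ⟨i, hi, hpos, hneg, hp, hn⟩ :=
    (μ.toSignedMeasure - ν.toSignedMeasure).toJordanDecomposition_spec
  rw [tvDist, SignedMeasure.totalVariation, measureReal_add_apply, hp, hn,
    SignedMeasure.toMeasureOfZeroLE_real_apply _ hpos hi MeasurableSet.univ,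
    SignedMeasure.toMeasureOfLEZero_real_apply _ hneg hi.compl MeasurableSet.univ,
    Set.inter_univ, Set.inter_univ, Measure.toSignedMeasure_sub_apply hi,
    Measure.toSignedMeasure_sub_apply hi.compl]
  linarith [(abs_le.1 (h i hi)).2, (abs_le.1 (h iᶜ hi.compl)).1]

/-- Probability measures that form a Cauchy sequence uniformly on measurable sets have a limit: the
pointwise limit is σ-additive because the limit in `n` may be exchanged with the limit of the
partial sums. -/
theorem exists_isProbabilityMeasure_of_uniform_cauchy (α : ℕ → Measure S)
    [∀ n, IsProbabilityMeasure (α n)] {c : ℕ → ℝ} (hc : Tendsto c atTop (𝓝 0))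
    (h : ∀ n m A, MeasurableSet A → |(α n).real A - (α (n + m)).real A| ≤ c n) :
    ∃ μ : Measure S, IsProbabilityMeasure μ ∧
      ∀ n A, MeasurableSet A → |(α n).real A - μ.real A| ≤ c n := by
  have hlim : ∀ A : Set S, MeasurableSet A →
      ∃ l : ℝ, Tendsto (fun n => (α n).real A) atTop (𝓝 l) := by
    intro A hA
    refine cauchySeq_tendsto_of_complete (cauchySeq_of_le_tendsto_0' c (fun n k hnk => ?_) hc)
    obtain ⟨m, rfl⟩ := Nat.exists_eq_add_of_le hnk
    exact h n m A hA
  choose! l hl using hlim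
  have hdist : ∀ n A, MeasurableSet A → |(α n).real A - l A| ≤ c n := fun n A hA =>
    le_of_tendsto ((tendsto_const_nhds.sub ((tendsto_add_atTop_iff_nat n).2 (hl A hA))).abs)
      (Eventually.of_forall fun m => by rw [add_comm m n]; exact h n m A hA)
  have hl0 : ∀ A, MeasurableSet A → 0 ≤ l A := fun A hA =>
    ge_of_tendsto' (hl A hA) fun _ => measureReal_nonneg
  have hempty : l ∅ = 0 := tendsto_nhds_unique (hl ∅ MeasurableSet.empty) (by simp)
  have huniv : l Set.univ = 1 := tendsto_nhds_unique (hl _ MeasurableSet.univ) (by simp)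
  have hsum : ∀ f : ℕ → Set S, (∀ i, MeasurableSet (f i)) → Pairwise (Function.onFun Disjoint f) →
      HasSum (fun i => l (f i)) (l (⋃ i, f i)) := by
    intro f hf hd
    have hpart : ∀ k, MeasurableSet (⋃ i ∈ Finset.range k, f i) := fun k =>
      Finset.measurableSet_biUnion _ fun i _ => hf i
    have hαk : ∀ n k, (α n).real (⋃ i ∈ Finset.range k, f i) =
        ∑ i ∈ Finset.range k, (α n).real (f i) := fun n k =>
      measureReal_biUnion_finset (fun i _ j _ hij => hd hij) fun i _ => hf i
    have hlk : ∀ k, l (⋃ i ∈ Finset.range k, f i) = ∑ i ∈ Finset.range k, l (f i) := by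
      intro k
      refine tendsto_nhds_unique (hl _ (hpart k)) ?_
      simp_rw [hαk]
      exact tendsto_finsetSum _ fun i _ => hl _ (hf i)
    refine (hasSum_iff_tendsto_nat_of_nonneg (fun i => hl0 _ (hf i)) _).2 ?_
    simp_rw [← hlk]
    have hunif : TendstoUniformly (fun n k => (α n).real (⋃ i ∈ Finset.range k, f i))
        (fun k => l (⋃ i ∈ Finset.range k, f i)) atTop := by
      rw [Metric.tendstoUniformly_iff]
      intro ε hε
      filter_upwards [hc.eventually_lt_const hε] with n hn k
      rw [dist_comm, Real.dist_eq]
      exact (hdist n _ (hpart k)).trans_lt hn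
    refine hunif.tendsto_of_eventually_tendsto (Eventually.of_forall fun n => ?_)
      (hl _ (MeasurableSet.iUnion hf))
    simp_rw [hαk]
    refine HasSum.tendsto_sum_nat ?_
    have hU := measure_iUnion (μ := α n) (fun i j hij => hd hij) hf
    rw [measureReal_def, hU]
    rw [ENNReal.tsum_toReal_eq fun i => measure_ne_top _ _]
    exact ENNReal.hasSum_toReal (hU ▸ measure_ne_top _ _)
  let μ : Measure S := Measure.ofMeasurable (fun A _ => ENNReal.ofReal (l A))
    (by simp [hempty]) fun f hf hd => by
      rw [← (hsum f hf hd).tsum_eq]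
      exact ENNReal.ofReal_tsum_of_nonneg (fun i => hl0 _ (hf i)) (hsum f hf hd).summable
  have hμ : ∀ A, MeasurableSet A → μ A = ENNReal.ofReal (l A) := fun A hA =>
    Measure.ofMeasurable_apply A hA
  refine ⟨μ, ⟨by rw [hμ _ MeasurableSet.univ, huniv, ENNReal.ofReal_one]⟩, fun n A hA => ?_⟩
  rw [measureReal_def μ, hμ A hA, ENNReal.toReal_ofReal (hl0 A hA)]
  exact hdist n A hA

/-- A Markov kernel does not increase the distance of two measures, uniformly on sets. By the layer
cake formula the integral of `x ↦ P(x, A)` is an average of measures of its superlevel sets. -/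
theorem bind_apply_le_add (P : Kernel S S) [IsMarkovKernel P] {α β : Measure S} {c : ℝ≥0∞}
    (h : ∀ A, MeasurableSet A → α A ≤ β A + c) {A : Set S} (hA : MeasurableSet A) :
    (P ∘ₘ α) A ≤ (P ∘ₘ β) A + c := by
  have hmeas : Measurable fun x => (P x).real A := (P.measurable_coe hA).ennreal_toReal
  have hcake : ∀ γ : Measure S,
      (P ∘ₘ γ) A = ∫⁻ t in Set.Ioo (0 : ℝ) 1, γ {x | t < (P x).real A} := by
    intro γ
    have hset : ∫⁻ t in Set.Ioo (0 : ℝ) 1, γ {x | t < (P x).real A} =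
        ∫⁻ t in Set.Ioi (0 : ℝ), γ {x | t < (P x).real A} := by
      rw [← lintegral_indicator measurableSet_Ioo, ← lintegral_indicator measurableSet_Ioi]
      congr 1 with t
      by_cases ht1 : t < 1
      · simp [Set.indicator_apply, ht1]
      · have hem : {x | t < (P x).real A} = ∅ :=
          Set.eq_empty_of_forall_notMem fun x hx =>
            absurd hx (not_lt.2 (measureReal_le_one.trans (not_lt.1 ht1)))
        simp [Set.indicator_apply, hem]
    rw [hset, ← lintegral_eq_lintegral_meas_lt γ (Eventually.of_forall fun _ => measureReal_nonneg)
      hmeas.aemeasurable, Measure.bind_apply hA (Kernel.aemeasurable _)]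
    simp
  rw [hcake, hcake]
  calc ∫⁻ t in Set.Ioo (0 : ℝ) 1, α {x | t < (P x).real A}
      ≤ ∫⁻ t in Set.Ioo (0 : ℝ) 1, (β {x | t < (P x).real A} + c) :=
        lintegral_mono fun t => h _ (measurableSet_lt measurable_const hmeas)
    _ = _ := by rw [lintegral_add_right _ measurable_const]; simp

end Limit

/-! ### The invariant law and the rate of convergence -/

section Invariant

variable {S : Type*} [MeasurableSpace S]

theorem pow_add_apply (P : Kernel S S) (n m : ℕ) (x : S) :
    (P ^ (n + m)) x = (P ^ n) ∘ₘ ((P ^ m) x) := by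
  rw [pow_add]
  exact Kernel.comp_apply (P ^ n) (P ^ m) x

theorem pow_apply_eq_bind_dirac (P : Kernel S S) (n : ℕ) (x : S) :
    (P ^ n) x = (P ^ n) ∘ₘ Measure.dirac x :=
  (Measure.dirac_bind (Kernel.measurable _) x).symm

theorem bind_pow_of_invariant {P : Kernel S S} {μ : Measure S} (hμ : P.Invariant μ) (n : ℕ) :
    (P ^ n) ∘ₘ μ = μ := by
  induction n with
  | zero => exact Measure.bind_dirac
  | succ n ih =>
    rw [pow_succ']
    change (P ∘ₖ (P ^ n)) ∘ₘ μ = μ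
    rw [← Measure.comp_assoc, ih]
    exact hμ

theorem abs_bind_pow_real_sub_le_of_invariant (P : Kernel S S) [IsMarkovKernel P]
    (hP : PreservesMeasurable P) {μ : Measure S} [IsProbabilityMeasure μ] (hμ : P.Invariant μ)
    (n : ℕ) (ν : Measure S) [IsProbabilityMeasure ν] {A : Set S} (hA : MeasurableSet A) :
    |((P ^ n) ∘ₘ ν).real A - μ.real A| ≤ ‖V P hP ^ n‖ := by
  have h := abs_bind_pow_real_sub_le P hP n ν μ hA
  rwa [bind_pow_of_invariant hμ] at h

theorem tvDist_bind_pow_le (P : Kernel S S) [IsMarkovKernel P]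
    (hP : PreservesMeasurable P) {μ : Measure S} [IsProbabilityMeasure μ] (hμ : P.Invariant μ)
    (n : ℕ) (ν : Measure S) [IsProbabilityMeasure ν] :
    tvDist ((P ^ n) ∘ₘ ν) μ ≤ 2 * ‖V P hP ^ n‖ :=
  tvDist_le_of_forall_abs_sub_le _ _ fun _ hA =>
    abs_bind_pow_real_sub_le_of_invariant P hP hμ n ν hA

theorem tvDist_pow_apply_le (P : Kernel S S) [IsMarkovKernel P]
    (hP : PreservesMeasurable P) {μ : Measure S} [IsProbabilityMeasure μ] (hμ : P.Invariant μ)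
    (n : ℕ) (x : S) : tvDist ((P ^ n) x) μ ≤ 2 * ‖V P hP ^ n‖ :=
  tvDist_le_of_forall_abs_sub_le _ _ fun _ hA => by
    rw [pow_apply_eq_bind_dirac]
    exact abs_bind_pow_real_sub_le_of_invariant P hP hμ n _ hA

theorem tendsto_norm_V_pow (P : Kernel S S) [IsMarkovKernel P] (hP : PreservesMeasurable P)
    (hr : rV P hP < 1) : Tendsto (fun n : ℕ => ‖V P hP ^ n‖) atTop (𝓝 0) := by
  obtain ⟨ρ, hρ, hρ1⟩ := exists_between hr
  have hρ0 : 0 ≤ ρ := ENNReal.toReal_nonneg.trans hρ.le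
  refine squeeze_zero' (Eventually.of_forall fun n => norm_nonneg _) ?_
    (tendsto_pow_atTop_nhds_zero_of_lt_one hρ0 hρ1)
  simpa using eventually_mul_norm_pow_le (V P hP) hρ 1

theorem invariant_law_unique (P : Kernel S S) [IsMarkovKernel P] (hP : PreservesMeasurable P)
    (hr : rV P hP < 1) {μ ν : Measure S} [IsProbabilityMeasure μ] [IsProbabilityMeasure ν]
    (hμ : P.Invariant μ) (hν : P.Invariant ν) : ν = μ := by
  refine Measure.ext fun A hA => (measureReal_eq_measureReal_iff).1 ?_
  have h : |ν.real A - μ.real A| ≤ 0 := ge_of_tendsto' (tendsto_norm_V_pow P hP hr) fun n => by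
    have h := abs_bind_pow_real_sub_le_of_invariant P hP hμ n ν hA
    rwa [bind_pow_of_invariant hν] at h
  exact sub_eq_zero.1 (abs_nonpos_iff.1 h)

/-- The laws of the chain from any starting point converge uniformly on sets, since
`P ^ (n + m) x` is the law at time `n` of the chain started from `P ^ m x`, and one more step of the
chain fixes the limit. -/
theorem exists_invariant_law [Nonempty S] (P : Kernel S S) [IsMarkovKernel P]
    (hP : PreservesMeasurable P) (hr : rV P hP < 1) :
    ∃ μ : Measure S, IsProbabilityMeasure μ ∧ P.Invariant μ := by
  obtain ⟨x⟩ := ‹Nonempty S›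
  have hc := tendsto_norm_V_pow P hP hr
  obtain ⟨μ, hμ, hdist⟩ := exists_isProbabilityMeasure_of_uniform_cauchy (fun n => (P ^ n) x) hc
    fun n m A hA => by
      rw [pow_add_apply, pow_apply_eq_bind_dirac P n]
      exact abs_bind_pow_real_sub_le P hP n _ _ hA
  refine ⟨μ, hμ, ?_⟩
  have hle : ∀ (α β : Measure S) [IsFiniteMeasure α] [IsFiniteMeasure β] (A : Set S) (c : ℝ),
      0 ≤ c → |α.real A - β.real A| ≤ c → α A ≤ β A + ENNReal.ofReal c := by
    intro α β _ _ A c hc h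
    rw [← ofReal_measureReal (μ := α), ← ofReal_measureReal (μ := β),
      ← ENNReal.ofReal_add measureReal_nonneg hc]
    exact ENNReal.ofReal_le_ofReal (by linarith [(abs_le.1 h).2])
  have hstep : ∀ n A, MeasurableSet A → μ A ≤ (P ∘ₘ μ) A +
      (ENNReal.ofReal ‖V P hP ^ n‖ + ENNReal.ofReal ‖V P hP ^ (n + 1)‖) := by
    intro n A hA
    have h1 : μ A ≤ (P ^ (n + 1)) x A + ENNReal.ofReal ‖V P hP ^ (n + 1)‖ :=
      hle _ _ A _ (norm_nonneg _) (abs_sub_comm (μ.real A) _ ▸ hdist (n + 1) A hA)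
    have h2 : (P ∘ₘ ((P ^ n) x)) A ≤ (P ∘ₘ μ) A + ENNReal.ofReal ‖V P hP ^ n‖ :=
      bind_apply_le_add P (fun B hB => hle _ _ B _ (norm_nonneg _) (hdist n B hB)) hA
    have h3 : (P ^ (n + 1)) x = P ∘ₘ ((P ^ n) x) := by
      rw [add_comm, pow_add_apply, pow_one]
    rw [h3] at h1
    calc μ A ≤ _ := h1
      _ ≤ (P ∘ₘ μ) A + ENNReal.ofReal ‖V P hP ^ n‖ + ENNReal.ofReal ‖V P hP ^ (n + 1)‖ := by
        gcongr
      _ = _ := add_assoc _ _ _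
  have hlim : Tendsto (fun n : ℕ =>
      ENNReal.ofReal ‖V P hP ^ n‖ + ENNReal.ofReal ‖V P hP ^ (n + 1)‖) atTop (𝓝 0) := by
    have h := ENNReal.tendsto_ofReal hc
    simpa using h.add ((tendsto_add_atTop_iff_nat 1).2 h)
  -- One inequality suffices, because both measures have total mass one.
  have hmono : μ ≤ P ∘ₘ μ := Measure.le_iff.2 fun A hA =>
    ge_of_tendsto' (by simpa using hlim.const_add ((P ∘ₘ μ) A)) fun n => hstep n A hA
  exact (Measure.eq_of_le_of_isProbabilityMeasure hmono).symm

end Invariant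

end MarkovCoupling

theorem corollary1 {S : Type*} [MeasurableSpace S] [Nonempty S] (P : Kernel S S)
    [IsMarkovKernel P] (hP : PreservesMeasurable P) (hr : rV P hP < 1) :
    ∃ (μ : Measure S) (_ : IsProbabilityMeasure μ),
      P.Invariant μ ∧
      (∀ (ν : Measure S) [IsProbabilityMeasure ν], P.Invariant ν → ν = μ) ∧
      (∀ (ν : Measure S) [IsProbabilityMeasure ν] (ρ : ℝ), rV P hP < ρ →
        ∃ C : ℝ, ∀ n : ℕ, tvDist ((P ^ n) ∘ₘ ν) μ ≤ C * ρ ^ n) ∧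
      (∀ (x : S) (ε : ℝ), 0 < ε →
        ∃ N : ℕ, ∀ n : ℕ, N ≤ n → tvDist ((P ^ n) x) μ ≤ (rV P hP + ε) ^ n) ∧
      (∀ (x : S) (ε : ℝ), 0 < ε → rV P hP + ε < 1 - kappaInf P →
        ∃ N : ℕ, ∀ n : ℕ, N ≤ n →
          tvDist ((P ^ n) x) μ ≤ (rV P hP + ε) ^ n ∧
          (rV P hP + ε) ^ n < (1 - kappaInf P) ^ n) := by
  obtain ⟨μ, hμ, hinv⟩ := exists_invariant_law P hP hr
  have hrate : ∀ (x : S) (ε : ℝ), 0 < ε →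
      ∃ N : ℕ, ∀ n : ℕ, N ≤ n → tvDist ((P ^ n) x) μ ≤ (rV P hP + ε) ^ n := by
    intro x ε hε
    obtain ⟨N, hN⟩ := eventually_atTop.1
      (eventually_mul_norm_pow_le (V P hP) (lt_add_of_pos_right (rV P hP) hε) 2)
    exact ⟨N, fun n hn => (tvDist_pow_apply_le P hP hinv n x).trans (hN n hn)⟩
  refine ⟨μ, hμ, hinv, fun ν _ hν => invariant_law_unique P hP hr hinv hν, ?_, hrate, ?_⟩
  · intro ν _ ρ hρ
    obtain ⟨C, hC⟩ := exists_norm_pow_le (V P hP) hρ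
    refine ⟨2 * C, fun n => (tvDist_bind_pow_le P hP hinv n ν).trans ?_⟩
    rw [mul_assoc]
    exact mul_le_mul_of_nonneg_left (hC n) zero_le_two
  · intro x ε hε hlt
    obtain ⟨N, hN⟩ := hrate x ε hε
    have h0 : 0 ≤ rV P hP + ε := add_nonneg ENNReal.toReal_nonneg hε.le
    -- The strict inequality fails for `n = 0`, so `N` is raised by one.
    refine ⟨N + 1, fun n hn => ⟨hN n (by omega), pow_lt_pow_left₀ hlt h0 (by omega)⟩⟩
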